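/- **Setting.** $M\ge 1$ clients share $N\ge M$ channels during $T$ rounds. In each round $t=1,\dots,T$ every channel is Good or Bad; the states are fixed in advance, drawn from some distribution, and do not react to the scheduler. A scheduling policy $\pi$ (possibly randomized, and allowed to depend on $M,N,T$ and on the distribution of the states) assigns in each round pairwise distinct channels to the clients, knowing only the allocations of the previous rounds and which transmissions succeeded in them; client $i$ succeeds in round $t$ iff its channel is Good. The age of information of client $i$ is $a_i(0)=1$, $a_i(t)=1$ if client $i$ succeeds in round $t$, and $a_i(t)=a_i(t-1)+1$ otherwise. The AoI regret of $\pi$ against an oracle is $$R_\pi(T)=\sum_{i=1}^M\sum_{t=1}^T\mathbb E\big[a_i^\pi(t)-a_i^*(t)\big],$$ where $a_i^*$ is the age under the oracle and the expectation is over the channel configuration, the channel states and the policy. **Theorem.** There is an absolute constant $c>0$ such that for all integers $M\ge1$, $N\ge M$, $T\ge 0$ with $N-M\le 2M\sqrt{NT}$ (in particular whenever $T\ge N$) there is a distribution of channel states of the following kind: a vector $\theta\in[0,1]^N$ of channel means (a configuration) is drawn at random once, and, given $\theta$, all channel states are independent and channel $j$ is Good with probability $\theta_j$ in every round. For this distribution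 every scheduling policy $\pi$ satisfies $$R_\pi(T)\ \ge\ c\,\frac{(N-M)^2}{N^2}\sqrt{NT},$$ both when the oracle has access to the channel states (so that it attains, for the realized states, the smallest possible value of $\sum_{i,t}a_i(t)$) and when the oracle knows only the drawn configuration $\theta$ and uses in all rounds the one fixed allocation that minimizes the expected value of $\sum_{i,t}a_i(t)$ given $\theta$. -/

import Mathlib

open MeasureTheory

namespace AoISched

/-- A channel allocation: the `M` clients receive pairwise distinct channels out of `N`. -/
abbrev Alloc (M N : ℕ) : Type := Fin M ↪ Fin N

/-- The Good (`true`) / Bad (`false`) states of the `N` channels in the rounds `1, …, T`;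
the index `t : Fin T` stands for round `t + 1`. -/
abbrev States (N T : ℕ) : Type := Fin T → Fin N → Bool

/-- A (possibly randomized) scheduling policy. Before each round it knows the allocations of the
`t` previous rounds and which clients' transmissions succeeded in them (nothing else about the
channel states), and it draws the next allocation from a distribution depending on these data. -/
def Policy (M N : ℕ) : Type :=
  (t : ℕ) → (Fin t → Alloc M N) → (Fin t → Fin M → Bool) → PMF (Alloc M N)

variable {M N T : ℕ}

/-- Outcome of client `i`'s transmission: the state of the channel allocated to it. -/
def success (x : States N T) (k : Fin T → Alloc M N) (t : Fin T) (i : Fin M) : Bool :=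
  x t (k t i)

/-- Age of information `a_i(t)` of a client at the end of round `t`, where `g` lists the outcomes
of its transmissions: `a_i(0) = 1`; the age becomes `1` after a success and otherwise grows
by `1`. -/
def age (g : Fin T → Bool) : ℕ → ℕ
  | 0 => 1
  | t + 1 => if ∃ h : t < T, g ⟨t, h⟩ = true then 1 else age g t + 1

/-- The cumulative age `∑_{i=1}^M ∑_{t=1}^T a_i(t)` of all clients. -/
def totalAge (x : States N T) (k : Fin T → Alloc M N) : ℝ :=
  ∑ i : Fin M, ∑ t : Fin T, (age (fun s => success x k s i) (t + 1) : ℝ)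

/-- Probability of the state sequence `x` when all channel states are independent and channel `j`
is Good with probability `θ j` in every round. -/
noncomputable def stateProb (θ : Fin N → unitInterval) (x : States N T) : ℝ :=
  ∏ t : Fin T, ∏ j : Fin N, if x t j then (θ j : ℝ) else 1 - (θ j : ℝ)

/-- Probability that the policy `π` produces the allocations `k` in the rounds `1, …, T` when
the channel states are `x`. -/
noncomputable def allocProb (π : Policy M N) (x : States N T) (k : Fin T → Alloc M N) : ℝ :=
  ∏ t : Fin T,
    (π t (fun s : Fin (t : ℕ) => k (Fin.castLE t.isLt.le s))
      (fun s : Fin (t : ℕ) => success x k (Fin.castLE t.isLt.le s)) (k t)).toReal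

/-- Expectation over independent Bernoulli channel states with means `θ`. -/
noncomputable def stateExp (θ : Fin N → unitInterval) (f : States N T → ℝ) : ℝ :=
  ∑ x : States N T, stateProb θ x * f x

/-- Expectation, for fixed channel states `x`, over the randomization of the policy. -/
noncomputable def policyExp (π : Policy M N) (x : States N T)
    (f : (Fin T → Alloc M N) → ℝ) : ℝ :=
  ∑ k : Fin T → Alloc M N, allocProb π x k * f k

/-- AoI regret over `T` rounds of the policy `π` against the oracle that has access to the
channel states, when the configuration of channel means is drawn from `ρ` once, before
round `1`. For the realized state sequence the oracle attains the smallest cumulative age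
of all sequences of allocations. -/
noncomputable def regretCSI (T : ℕ) (ρ : Measure (Fin N → unitInterval)) (π : Policy M N) : ℝ :=
  ∫ θ, stateExp θ (fun x : States N T =>
    policyExp π x (totalAge x) - ⨅ k : Fin T → Alloc M N, totalAge x k) ∂ρ

/-- AoI regret over `T` rounds of the policy `π` against the oracle that knows only the drawn
configuration `θ` of channel means, not the states, and uses in all rounds one and the same
allocation, the best one for `θ`. -/
noncomputable def regretBestArm (T : ℕ) (ρ : Measure (Fin N → unitInterval))
    (π : Policy M N) : ℝ :=
  ∫ θ, (stateExp θ (fun x : States N T => policyExp π x (totalAge x)) -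
    ⨅ k : Alloc M N, stateExp θ (fun x : States N T => totalAge x (fun _ => k))) ∂ρ

end AoISched

open AoISched

/-! The hard instance hides a window of `M` cyclically consecutive channels of mean `1/2 + ε`, with
uniformly random starting point, among fair channels. Ages are at least `1`, so each client-round
spent outside the window adds at least `ε` to the expected total age, and the allocation filling the
window never misses (`exp_sumAge_ge`, `le_stateExp_sub_iInf`).

It remains to show that no policy finds the window quickly. Compare with all channels fair, and let
`E a` be the expected number of client-rounds spent in window `a` there. Only transmissions in the
window carry information, each at most `4 * ε ^ 2` of relative entropy, so the two laws of the
history are at `L¹` distance at most `4 * ε * √(E a)` (`sq_sum_abs_one_sub_le`). As the uses never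
exceed `M * T`, raising the means increases their expectation by at most `M * T * (4 * ε * √(E a))`
(`exp_uses_le`).

Each channel lies in exactly `M` windows, so the `E a` sum to `M * (M * T)`, and Cauchy–Schwarz
bounds the sum of their square roots by `M * √(N * T)`. With `8 * ε * M * √(N * T) = N - M`, the
average number of misses is at least `M * T * (N - M) / (2 * N)` (`sum_exp_misses_ge`); multiplying
by `ε` gives the bound with `c = 1/16`. An oracle that sees the states does at least as well as a
fixed allocation, so the regret against it is no smaller. -/

namespace AoISched

/-! ### Sequentially drawn outcomes -/

section Adaptive

variable {Y : Type*}

/-- Weight of a sequence of outcomes drawn one after the other, each from a distribution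
that depends on the earlier outcomes. -/
def adaptiveWeight (w : (t : ℕ) → (Fin t → Y) → Y → ℝ) (T : ℕ) (h : Fin T → Y) : ℝ :=
  ∏ t : Fin T, w t (fun s => h (Fin.castLE t.isLt.le s)) (h t)

variable {w : (t : ℕ) → (Fin t → Y) → Y → ℝ} {T : ℕ}

theorem adaptiveWeight_snoc (h : Fin T → Y) (y : Y) :
    adaptiveWeight w (T + 1) (Fin.snoc h y : Fin (T + 1) → Y) = adaptiveWeight w T h * w T h y := by
  unfold adaptiveWeight
  rw [Fin.prod_univ_castSucc]
  congr 1
  · refine Finset.prod_congr rfl fun t _ => ?_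
    rw [Fin.snoc_castSucc]
    congr 1
    funext s
    exact Fin.snoc_castSucc (α := fun _ => Y) y h (Fin.castLE t.isLt.le s)
  · rw [Fin.snoc_last]
    congr 1
    funext s
    exact Fin.snoc_castSucc (α := fun _ => Y) y h s

variable [Fintype Y]

/-- Expectation with respect to `adaptiveWeight`. -/
def adaptiveExp (w : (t : ℕ) → (Fin t → Y) → Y → ℝ) (T : ℕ) (F : (Fin T → Y) → ℝ) : ℝ :=
  ∑ h, adaptiveWeight w T h * F h

theorem adaptiveExp_succ (F : (Fin (T + 1) → Y) → ℝ) :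
    adaptiveExp w (T + 1) F =
      adaptiveExp w T (fun h => ∑ y, w T h y * F (Fin.snoc h y : Fin (T + 1) → Y)) := by
  unfold adaptiveExp
  rw [← (Fin.snocEquiv fun _ : Fin (T + 1) => Y).sum_comp, Fintype.sum_prod_type_right]
  refine Finset.sum_congr rfl fun h _ => ?_
  rw [Finset.mul_sum]
  refine Finset.sum_congr rfl fun y _ => ?_
  have : (Fin.snocEquiv fun _ : Fin (T + 1) => Y) (y, h) = (Fin.snoc h y : Fin (T + 1) → Y) := rfl
  rw [this, adaptiveWeight_snoc, mul_assoc]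

theorem adaptiveExp_add (F G : (Fin T → Y) → ℝ) :
    adaptiveExp w T (fun h => F h + G h) = adaptiveExp w T F + adaptiveExp w T G := by
  simp only [adaptiveExp, mul_add, Finset.sum_add_distrib]

theorem adaptiveExp_sum {ι : Type*} (s : Finset ι) (F : ι → (Fin T → Y) → ℝ) :
    adaptiveExp w T (fun h => ∑ i ∈ s, F i h) = ∑ i ∈ s, adaptiveExp w T (F i) := by
  simp only [adaptiveExp, Finset.mul_sum]
  exact Finset.sum_comm

theorem adaptiveExp_const_mul (c : ℝ) (F : (Fin T → Y) → ℝ) :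
    adaptiveExp w T (fun h => c * F h) = c * adaptiveExp w T F := by
  simp only [adaptiveExp, Finset.mul_sum, mul_left_comm]

/-- The kernels `w` are probability distributions. -/
structure IsStochastic (w : (t : ℕ) → (Fin t → Y) → Y → ℝ) : Prop where
  nonneg : ∀ t h y, 0 ≤ w t h y
  sum_eq_one : ∀ t h, ∑ y, w t h y = 1

namespace IsStochastic

theorem weight_nonneg (hw : IsStochastic w) (h : Fin T → Y) : 0 ≤ adaptiveWeight w T h :=
  Finset.prod_nonneg fun _ _ => hw.nonneg _ _ _

theorem exp_mono (hw : IsStochastic w) {F G : (Fin T → Y) → ℝ} (hFG : ∀ h, F h ≤ G h) :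
    adaptiveExp w T F ≤ adaptiveExp w T G :=
  Finset.sum_le_sum fun h _ => mul_le_mul_of_nonneg_left (hFG h) (hw.weight_nonneg h)

theorem exp_const (hw : IsStochastic w) (c : ℝ) : adaptiveExp w T (fun _ => c) = c := by
  induction T with
  | zero => simp [adaptiveExp, adaptiveWeight]
  | succ T ih => simp only [adaptiveExp_succ, ← Finset.sum_mul, hw.sum_eq_one, one_mul, ih]

theorem sum_weight (hw : IsStochastic w) : ∑ h, adaptiveWeight w T h = 1 := by
  simpa [adaptiveExp] using hw.exp_const (T := T) 1

theorem exp_additive_succ (hw : IsStochastic w) (φ : Y → ℝ) :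
    adaptiveExp w (T + 1) (fun h => ∑ t, φ (h t)) =
      adaptiveExp w T (fun h => ∑ t, φ (h t)) + adaptiveExp w T (fun h => ∑ y, w T h y * φ y) := by
  rw [adaptiveExp_succ, ← adaptiveExp_add]
  congr 1
  funext h
  simp only [Fin.sum_univ_castSucc, Fin.snoc_castSucc, Fin.snoc_last, mul_add,
    Finset.sum_add_distrib, ← Finset.sum_mul, hw.sum_eq_one, one_mul]

/-- Conditional expectations given the past add up over the rounds. This is the chain rule that
turns relative entropy into a sum over rounds. -/
theorem exp_additive_congr (hw : IsStochastic w) {φ ψ : Y → ℝ}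
    (hφ : ∀ t h, ∑ y, w t h y * φ y = ∑ y, w t h y * ψ y) :
    adaptiveExp w T (fun h => ∑ t, φ (h t)) = adaptiveExp w T (fun h => ∑ t, ψ (h t)) := by
  induction T with
  | zero => simp
  | succ T ih => simp only [hw.exp_additive_succ, ih, hφ]

end IsStochastic

end Adaptive

/-! ### Total variation and relative entropy -/

/-- If a density `R` relative to the weights `p` has total mass one, then its total variation
distance from one is controlled by the relative entropy. -/
theorem sq_sum_abs_one_sub_le {ι : Type*} [Fintype ι] {p R : ι → ℝ} (hp : ∀ i, 0 ≤ p i)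
    (hR : ∀ i, 0 < R i) (hp1 : ∑ i, p i = 1) (hpR : ∑ i, p i * R i = 1) :
    (∑ i, p i * |1 - R i|) ^ 2 ≤ 4 * ∑ i, p i * -Real.log (R i) := by
  have hsq : ∀ i, √(R i) ^ 2 = R i := fun i => Real.sq_sqrt (hR i).le
  -- Cauchy–Schwarz for the factorization `|1 - R| = |1 - √R| * (1 + √R)`.
  have cs := Finset.sum_mul_sq_le_sq_mul_sq Finset.univ
    (fun i => √(p i) * |1 - √(R i)|) (fun i => √(p i) * (1 + √(R i)))
  have e0 : ∀ i, √(p i) * |1 - √(R i)| * (√(p i) * (1 + √(R i))) = p i * |1 - R i| := by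
    intro i
    have h1 : 0 ≤ 1 + √(R i) := by positivity
    have h2 : 1 - R i = (1 - √(R i)) * (1 + √(R i)) := by linear_combination hsq i
    rw [h2, abs_mul, abs_of_nonneg h1]
    linear_combination (|1 - √(R i)| * (1 + √(R i))) * Real.sq_sqrt (hp i)
  -- From `log √R ≤ √R - 1`. The correction `p * R - p` sums to zero, both masses being one.
  have e1 : ∀ i, (√(p i) * |1 - √(R i)|) ^ 2 ≤
      p i * -Real.log (R i) + (p i * R i - p i) := by
    intro i
    rw [mul_pow, sq_abs, Real.sq_sqrt (hp i)]
    have h1 := Real.log_le_sub_one_of_pos (Real.sqrt_pos.2 (hR i))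
    rw [Real.log_sqrt (hR i).le] at h1
    nlinarith [hp i, hsq i, mul_nonneg (hp i) (sub_nonneg.2 h1)]
  have e2 : ∀ i, (√(p i) * (1 + √(R i))) ^ 2 ≤ 2 * p i + 2 * (p i * R i) := by
    intro i
    rw [mul_pow, Real.sq_sqrt (hp i)]
    nlinarith [hp i, hsq i, mul_nonneg (hp i) (sq_nonneg (1 - √(R i)))]
  have s1 := Finset.sum_le_sum fun i (_ : i ∈ Finset.univ) => e1 i
  have s2 := Finset.sum_le_sum fun i (_ : i ∈ Finset.univ) => e2 i
  simp only [Finset.sum_add_distrib, Finset.sum_sub_distrib, ← Finset.mul_sum, hp1, hpR] at s1 s2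
  simp only [e0] at cs
  have s0 : 0 ≤ ∑ i, (√(p i) * |1 - √(R i)|) ^ 2 := Finset.sum_nonneg fun i _ => sq_nonneg _
  nlinarith

/-! ### Products of Bernoulli weights -/

/-- Probability of the outcome `b` of a Bernoulli variable of mean `p`. -/
def bernoulliWeight (p : ℝ) (b : Bool) : ℝ := if b then p else 1 - p

theorem bernoulliWeight_nonneg (p : unitInterval) (b : Bool) : 0 ≤ bernoulliWeight p b := by
  cases b
  · simpa [bernoulliWeight] using p.2.2
  · simpa [bernoulliWeight] using p.2.1

theorem sum_prod_bernoulliWeight_mul {ι : Type*} [Fintype ι] [DecidableEq ι] (p : ι → ℝ) (i : ι)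
    (φ : Bool → ℝ) :
    ∑ g : ι → Bool, (∏ j, bernoulliWeight (p j) (g j)) * φ (g i) =
      ∑ b, bernoulliWeight (p i) b * φ b := by
  have h : ∀ g : ι → Bool, (∏ j, bernoulliWeight (p j) (g j)) * φ (g i) =
      ∏ j, bernoulliWeight (p j) (g j) * if j = i then φ (g j) else 1 := by
    intro g
    rw [Finset.prod_mul_distrib, Finset.prod_ite_eq' Finset.univ i, if_pos (Finset.mem_univ i)]
  simp only [h]
  rw [← Fintype.prod_sum (fun j b => bernoulliWeight (p j) b * if j = i then φ b else 1),
    Fintype.prod_eq_single i]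
  · simp
  · intro j hj
    simp [hj, bernoulliWeight]

theorem sum_prod_bernoulliWeight {ι : Type*} [Fintype ι] [DecidableEq ι] (p : ι → ℝ) :
    ∑ g : ι → Bool, ∏ j, bernoulliWeight (p j) (g j) = 1 := by
  rw [← Fintype.prod_sum (fun j b => bernoulliWeight (p j) b)]
  simp [bernoulliWeight]

/-- The marginal of a product of Bernoulli weights on the coordinates selected by an
embedding. -/
theorem sum_prod_bernoulliWeight_comp_eq {ι κ : Type*} [Fintype ι] [Fintype κ] [DecidableEq ι]
    [DecidableEq κ] (p : κ → ℝ) (k : ι ↪ κ) (g : ι → Bool) :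
    ∑ z : κ → Bool, (∏ j, bernoulliWeight (p j) (z j)) * (if z ∘ k = g then 1 else 0) =
      ∏ i, bernoulliWeight (p (k i)) (g i) := by
  -- The indicator is split over the fibres of `k`, which have at most one element, so that the sum
  -- over `z` factors over the channels.
  have h : ∀ z : κ → Bool, (∏ j, bernoulliWeight (p j) (z j)) * (if z ∘ k = g then 1 else 0) =
      ∏ j, bernoulliWeight (p j) (z j) *
        ∏ i ∈ Finset.univ.filter (fun i => k i = j), if z j = g i then (1 : ℝ) else 0 := by
    intro z
    rw [Finset.prod_mul_distrib]
    congr 1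
    have : ∀ j, ∏ i ∈ Finset.univ.filter (fun i => k i = j), (if z j = g i then (1 : ℝ) else 0) =
        ∏ i ∈ Finset.univ.filter (fun i => k i = j), if z (k i) = g i then (1 : ℝ) else 0 := by
      intro j
      refine Finset.prod_congr rfl fun i hi => ?_
      rw [(Finset.mem_filter.1 hi).2]
    simp only [this]
    rw [Finset.prod_fiberwise, Finset.prod_ite_zero]
    simp [funext_iff]
  simp only [h]
  rw [← Fintype.prod_sum (fun j b => bernoulliWeight (p j) b *
      ∏ i ∈ Finset.univ.filter (fun i => k i = j), if b = g i then (1 : ℝ) else 0),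
    ← Finset.prod_fiberwise Finset.univ k]
  refine Finset.prod_congr rfl fun j _ => ?_
  by_cases hj : ∃ i, k i = j
  · obtain ⟨i, rfl⟩ := hj
    simp only [k.injective.eq_iff, Finset.filter_eq', Finset.mem_univ, if_true,
      Finset.prod_singleton]
    simp
  · have : Finset.univ.filter (fun i => k i = j) = ∅ := by
      ext i
      simpa using fun h => hj ⟨i, h⟩
    simp [this, bernoulliWeight]

/-! ### The observed process of allocations and outcomes -/

variable {M N T : ℕ}

/-- Distribution of the allocation and the outcomes of one round given the previous rounds. -/
noncomputable def roundWeight (π : Policy M N) (θ : Fin N → unitInterval) (t : ℕ)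
    (h : Fin t → Alloc M N × (Fin M → Bool)) (y : Alloc M N × (Fin M → Bool)) : ℝ :=
  (π t (fun s => (h s).1) (fun s => (h s).2) y.1).toReal *
    ∏ i, bernoulliWeight (θ (y.1 i)) (y.2 i)

theorem sum_toReal_pmf {α : Type*} [Fintype α] (p : PMF α) : ∑ a, (p a).toReal = 1 := by
  rw [← ENNReal.toReal_sum fun a _ => p.apply_ne_top a, ← tsum_fintype (L := .unconditional α),
    p.tsum_coe, ENNReal.toReal_one]

theorem sum_roundWeight_mul (π : Policy M N) (θ : Fin N → unitInterval) (t : ℕ)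
    (h : Fin t → Alloc M N × (Fin M → Bool)) (i : Fin M) (φ : Alloc M N → Bool → ℝ) :
    ∑ y, roundWeight π θ t h y * φ y.1 (y.2 i) =
      ∑ k, (π t (fun s => (h s).1) (fun s => (h s).2) k).toReal *
        ∑ b, bernoulliWeight (θ (k i)) b * φ k b := by
  rw [Fintype.sum_prod_type]
  refine Finset.sum_congr rfl fun k _ => ?_
  rw [← sum_prod_bernoulliWeight_mul (fun i => (θ (k i) : ℝ)) i (φ k), Finset.mul_sum]
  exact Finset.sum_congr rfl fun g _ => mul_assoc _ _ _

theorem sum_roundWeight_fst (π : Policy M N) (θ : Fin N → unitInterval) (t : ℕ)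
    (h : Fin t → Alloc M N × (Fin M → Bool)) (φ : Alloc M N → ℝ) :
    ∑ y, roundWeight π θ t h y * φ y.1 =
      ∑ k, (π t (fun s => (h s).1) (fun s => (h s).2) k).toReal * φ k := by
  rw [Fintype.sum_prod_type]
  refine Finset.sum_congr rfl fun k _ => ?_
  simp only [roundWeight]
  rw [← Finset.sum_mul, ← Finset.mul_sum,
    sum_prod_bernoulliWeight (fun i => (θ (k i) : ℝ)), mul_one]

theorem isStochastic_roundWeight (π : Policy M N) (θ : Fin N → unitInterval) :
    IsStochastic (roundWeight π θ) where
  nonneg _ _ _ := mul_nonneg ENNReal.toReal_nonneg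
    (Finset.prod_nonneg fun _ _ => bernoulliWeight_nonneg _ _)
  sum_eq_one t h := by
    simpa [sum_toReal_pmf] using sum_roundWeight_fst π θ t h fun _ => 1

theorem stateProb_eq (θ : Fin N → unitInterval) (x : States N T) :
    stateProb θ x = ∏ t, ∏ j, bernoulliWeight (θ j) (x t j) := rfl

/-- For fixed allocations, the law of the outcomes of the transmissions. -/
theorem stateExp_success (θ : Fin N → unitInterval) (k : Fin T → Alloc M N)
    (H : (Fin T → Fin M → Bool) → ℝ) :
    stateExp θ (fun x => H (success x k)) =
      ∑ g : Fin T → Fin M → Bool, (∏ t, ∏ i, bernoulliWeight (θ (k t i)) (g t i)) * H g := by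
  have h1 : ∀ x : States N T, stateProb θ x * H (success x k) =
      ∑ g, (∏ t, (∏ j, bernoulliWeight (θ j) (x t j)) *
        (if x t ∘ k t = g t then (1 : ℝ) else 0)) * H g := by
    intro x
    rw [Finset.sum_eq_single (success x k)]
    · rw [Finset.prod_mul_distrib, Finset.prod_ite_zero, if_pos, Finset.prod_const_one, mul_one,
        stateProb_eq]
      exact fun t _ => rfl
    · intro g _ hg
      rw [Finset.prod_mul_distrib, Finset.prod_ite_zero, if_neg, mul_zero, zero_mul]
      exact fun h => hg (funext fun t => (h t (Finset.mem_univ t)).symm)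
    · simp
  simp only [stateExp, h1]
  rw [Finset.sum_comm]
  refine Finset.sum_congr rfl fun g _ => ?_
  rw [← Finset.sum_mul,
    ← Fintype.prod_sum (fun (t : Fin T) (z : Fin N → Bool) => (∏ j, bernoulliWeight (θ j) (z j)) *
        (if z ∘ k t = g t then (1 : ℝ) else 0))]
  congr 1
  exact Finset.prod_congr rfl fun t _ =>
    sum_prod_bernoulliWeight_comp_eq (fun j => (θ j : ℝ)) (k t) (g t)

/-- Expectations of functions of allocations and outcomes, in terms of the observed process. -/
theorem stateExp_policyExp (π : Policy M N) (θ : Fin N → unitInterval)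
    (F : (Fin T → Alloc M N) → (Fin T → Fin M → Bool) → ℝ) :
    stateExp θ (fun x => policyExp π x fun k => F k (success x k)) =
      adaptiveExp (roundWeight π θ) T fun h => F (fun t => (h t).1) (fun t => (h t).2) := by
  -- For fixed allocations the policy's probabilities depend on the states only through the observed
  -- outcomes, so they can be absorbed into a function of `success x k`.
  have h1 : stateExp θ (fun x => policyExp π x fun k => F k (success x k)) =
      ∑ k : Fin T → Alloc M N, stateExp θ (fun x => (fun g : Fin T → Fin M → Bool =>
        (∏ t : Fin T, (π t (fun s : Fin (t : ℕ) => k (Fin.castLE t.isLt.le s))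
          (fun s : Fin (t : ℕ) => g (Fin.castLE t.isLt.le s)) (k t)).toReal) * F k g)
            (success x k)) := by
    simp only [stateExp, policyExp, Finset.mul_sum]
    exact Finset.sum_comm
  rw [h1]
  simp only [adaptiveExp]
  rw [← (Equiv.arrowProdEquivProdArrow (Fin T) (fun _ => Alloc M N)
    (fun _ => Fin M → Bool)).symm.sum_comp, Fintype.sum_prod_type]
  refine Finset.sum_congr rfl fun k _ => (stateExp_success θ k fun g =>
    (∏ t : Fin T, (π t (fun s : Fin (t : ℕ) => k (Fin.castLE t.isLt.le s))
      (fun s : Fin (t : ℕ) => g (Fin.castLE t.isLt.le s)) (k t)).toReal) * F k g).trans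
    (Finset.sum_congr rfl fun g _ => ?_)
  rw [← mul_assoc, ← Finset.prod_mul_distrib]
  congr 1
  exact Finset.prod_congr rfl fun t _ => mul_comm _ _

/-- The policy that always uses the allocation `k`. -/
noncomputable def staticPolicy (k : Alloc M N) : Policy M N := fun _ _ _ => PMF.pure k

theorem policyExp_staticPolicy (k : Alloc M N) (x : States N T)
    (f : (Fin T → Alloc M N) → ℝ) : policyExp (staticPolicy k) x f = f fun _ => k := by
  classical
  have h : ∀ k' : Fin T → Alloc M N,
      allocProb (staticPolicy k) x k' = if k' = fun _ => k then 1 else 0 := by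
    intro k'
    simp only [allocProb, staticPolicy, PMF.pure_apply, apply_ite ENNReal.toReal,
      ENNReal.toReal_one, ENNReal.toReal_zero]
    split_ifs with hk
    · simp [hk]
    · obtain ⟨t, ht⟩ := not_forall.1 (mt funext hk)
      exact Finset.prod_eq_zero (Finset.mem_univ t) (if_neg ht)
  simp [policyExp, h]

/-! ### Recursion for the age -/

theorem age_congr {T T' : ℕ} {g : Fin T → Bool} {g' : Fin T' → Bool} (n : ℕ) (hn : n ≤ T)
    (hn' : n ≤ T')
    (h : ∀ s (hs : s < n), g ⟨s, hs.trans_le hn⟩ = g' ⟨s, hs.trans_le hn'⟩) :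
    age g n = age g' n := by
  induction n with
  | zero => rfl
  | succ n ih =>
    have h0 := h n n.lt_succ_self
    have h1 : n < T := hn
    have h2 : n < T' := hn'
    simp only [age, h1, h2, exists_true_left, h0,
      ih h1.le h2.le fun s hs => h s (hs.trans n.lt_succ_self)]

theorem age_snoc {g : Fin T → Bool} {b : Bool} {n : ℕ} (hn : n ≤ T) :
    age (Fin.snoc g b : Fin (T + 1) → Bool) n = age g n :=
  age_congr n (hn.trans T.le_succ) hn fun s hs =>
    Fin.snoc_castSucc (α := fun _ => Bool) b g ⟨s, hs.trans_le hn⟩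

theorem age_snoc_succ (g : Fin T → Bool) (b : Bool) :
    age (Fin.snoc g b : Fin (T + 1) → Bool) (T + 1) = if b then 1 else age g T + 1 := by
  have h : (Fin.snoc g b : Fin (T + 1) → Bool) ⟨T, T.lt_succ_self⟩ = b :=
    Fin.snoc_last (α := fun _ => Bool) b g
  simp only [age, T.lt_succ_self, exists_true_left, h, age_snoc le_rfl]

theorem one_le_age (g : Fin T → Bool) (n : ℕ) : 1 ≤ age g n := by
  cases n with
  | zero => exact le_rfl
  | succ n =>
    rw [age]
    split_ifs <;> omega

theorem comp_snoc {α β : Type*} (f : α → β) (h : Fin T → α) (y : α) :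
    (fun s => f ((Fin.snoc h y : Fin (T + 1) → α) s)) =
      (Fin.snoc (fun s => f (h s)) (f y) : Fin (T + 1) → β) := by
  funext s
  refine Fin.lastCases ?_ (fun s => ?_) s <;> simp

/-- Age of client `i` after `T` observed rounds. -/
def finalAge (i : Fin M) (T : ℕ) (h : Fin T → Alloc M N × (Fin M → Bool)) : ℝ :=
  age (fun s => (h s).2 i) T

/-- Sum of the ages of client `i` in `T` observed rounds. -/
def sumAge (i : Fin M) (T : ℕ) (h : Fin T → Alloc M N × (Fin M → Bool)) : ℝ :=
  ∑ t : Fin T, (age (fun s => (h s).2 i) (t + 1) : ℝ)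

theorem one_le_finalAge (i : Fin M) (h : Fin T → Alloc M N × (Fin M → Bool)) :
    1 ≤ finalAge i T h :=
  Nat.one_le_cast.2 (one_le_age _ _)

theorem finalAge_snoc (i : Fin M) (h : Fin T → Alloc M N × (Fin M → Bool))
    (y : Alloc M N × (Fin M → Bool)) :
    finalAge i (T + 1) (Fin.snoc h y : Fin (T + 1) → Alloc M N × (Fin M → Bool)) =
      1 + (if y.2 i then 0 else 1) * finalAge i T h := by
  rw [finalAge, comp_snoc (fun y : Alloc M N × (Fin M → Bool) => y.2 i), age_snoc_succ]
  cases y.2 i <;> simp [finalAge, add_comm]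

theorem sumAge_snoc (i : Fin M) (h : Fin T → Alloc M N × (Fin M → Bool))
    (y : Alloc M N × (Fin M → Bool)) :
    sumAge i (T + 1) (Fin.snoc h y : Fin (T + 1) → Alloc M N × (Fin M → Bool)) =
      sumAge i T h +
        finalAge i (T + 1) (Fin.snoc h y : Fin (T + 1) → Alloc M N × (Fin M → Bool)) := by
  rw [sumAge, Fin.sum_univ_castSucc]
  congr 1
  refine Finset.sum_congr rfl fun t _ => ?_
  rw [comp_snoc (fun y : Alloc M N × (Fin M → Bool) => y.2 i), Fin.val_castSucc,
    age_snoc (Nat.succ_le_of_lt t.isLt)]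

variable (π : Policy M N) (θ : Fin N → unitInterval)

theorem exp_sumAge_succ (i : Fin M) :
    adaptiveExp (roundWeight π θ) (T + 1) (sumAge i (T + 1)) =
      adaptiveExp (roundWeight π θ) T (sumAge i T) +
        adaptiveExp (roundWeight π θ) (T + 1) (finalAge i (T + 1)) := by
  rw [adaptiveExp_succ, adaptiveExp_succ, ← adaptiveExp_add]
  congr 1
  funext h
  simp only [sumAge_snoc, mul_add, Finset.sum_add_distrib, ← Finset.sum_mul,
    (isStochastic_roundWeight π θ).sum_eq_one, one_mul]

/-- The new age is one plus the old age times the indicator of failure. Given the past, the failure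
probability is the average of `1 - θ (k i)` over the policy's next allocation. -/
theorem exp_finalAge_succ (i : Fin M) :
    adaptiveExp (roundWeight π θ) (T + 1) (finalAge i (T + 1)) =
      1 + adaptiveExp (roundWeight π θ) T (fun h =>
        (∑ k, (π T (fun s => (h s).1) (fun s => (h s).2) k).toReal * (1 - θ (k i))) *
          finalAge i T h) := by
  have hone := (isStochastic_roundWeight π θ).exp_const (T := T) 1
  nth_rewrite 1 [← hone]
  rw [adaptiveExp_succ, ← adaptiveExp_add]
  congr 1
  funext h
  have := sum_roundWeight_mul π θ T h i fun _ b => if b then (0 : ℝ) else 1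
  simp only [finalAge_snoc, mul_add, mul_one, Finset.sum_add_distrib, ← mul_assoc,
    ← Finset.sum_mul, (isStochastic_roundWeight π θ).sum_eq_one, this]
  simp [bernoulliWeight]

/-- Expected age after `t` rounds of a client that always uses a channel of mean `p`. -/
def meanAge (p : ℝ) : ℕ → ℝ
  | 0 => 1
  | t + 1 => 1 + (1 - p) * meanAge p t

/-- Number of rounds in which client `i` does not use a channel of `S`. -/
noncomputable def misses (S : Finset (Fin N)) (i : Fin M) (T : ℕ)
    (h : Fin T → Alloc M N × (Fin M → Bool)) : ℝ :=
  ∑ t : Fin T, if (h t).1 i ∈ S then 0 else 1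

/-! ### Cost of a miss -/

section LowerBound

variable {S : Finset (Fin N)} {p ε : ℝ}

/-- A miss raises the failure probability from `1 - p` to `1 - p + ε`. The extra `ε` multiplies the
current age, which is at least `1`. -/
theorem exp_finalAge_succ_ge (hε : 0 ≤ ε) (hS : ∀ j ∈ S, (θ j : ℝ) = p)
    (hS' : ∀ j ∉ S, (θ j : ℝ) = p - ε) (i : Fin M) :
    1 + (1 - p) * adaptiveExp (roundWeight π θ) T (finalAge i T) +
        ε * adaptiveExp (roundWeight π θ) T
          (fun h => ∑ y, roundWeight π θ T h y * if y.1 i ∈ S then 0 else 1) ≤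
      adaptiveExp (roundWeight π θ) (T + 1) (finalAge i (T + 1)) := by
  rw [exp_finalAge_succ, add_assoc, ← adaptiveExp_const_mul, ← adaptiveExp_const_mul,
    ← adaptiveExp_add]
  refine add_le_add_right ((isStochastic_roundWeight π θ).exp_mono fun h => ?_) 1
  rw [sum_roundWeight_fst π θ T h fun k => if k i ∈ S then 0 else 1]
  have h1 : ∑ k, (π T (fun s => (h s).1) (fun s => (h s).2) k).toReal * (1 - (θ (k i) : ℝ)) =
      (1 - p) + ε * ∑ k, (π T (fun s => (h s).1) (fun s => (h s).2) k).toReal *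
        (if k i ∈ S then 0 else 1) := by
    have h2 : 1 - p =
        ∑ k, (π T (fun s => (h s).1) (fun s => (h s).2) k).toReal * (1 - p) := by
      rw [← Finset.sum_mul, sum_toReal_pmf, one_mul]
    rw [h2, Finset.mul_sum, ← Finset.sum_add_distrib]
    refine Finset.sum_congr rfl fun k _ => ?_
    split_ifs with hk
    · rw [hS _ hk]
      ring
    · rw [hS' _ hk]
      ring
  rw [h1, add_mul]
  have h2 : 0 ≤ ε * ∑ k, (π T (fun s => (h s).1) (fun s => (h s).2) k).toReal *
      (if k i ∈ S then 0 else 1) :=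
    mul_nonneg hε (Finset.sum_nonneg fun k _ =>
      mul_nonneg ENNReal.toReal_nonneg (by split_ifs <;> norm_num))
  nlinarith [one_le_finalAge i h]

theorem meanAge_le_exp_finalAge (hp : p ≤ 1) (hε : 0 ≤ ε) (hS : ∀ j ∈ S, (θ j : ℝ) = p)
    (hS' : ∀ j ∉ S, (θ j : ℝ) = p - ε) (i : Fin M) :
    meanAge p T ≤ adaptiveExp (roundWeight π θ) T (finalAge i T) := by
  have hw := isStochastic_roundWeight π θ
  induction T with
  | zero =>
    simpa [meanAge, hw.exp_const] using hw.exp_mono fun h => one_le_finalAge i h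
  | succ T ih =>
    refine le_trans ?_ (exp_finalAge_succ_ge π θ hε hS hS' i)
    have h2 : 0 ≤ adaptiveExp (roundWeight π θ) T
        (fun h => ∑ y, roundWeight π θ T h y * if y.1 i ∈ S then 0 else 1) := by
      refine (hw.exp_const 0).ge.trans (hw.exp_mono fun h => Finset.sum_nonneg fun y _ =>
        mul_nonneg (hw.nonneg _ _ _) (by split_ifs <;> norm_num))
    rw [meanAge]
    nlinarith [mul_nonneg hε h2, mul_le_mul_of_nonneg_left ih (sub_nonneg.2 hp)]

/-- Only the immediate effect of a miss is counted: the age carried into each round is bounded below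
by `meanAge p`, as if no miss had occurred earlier. -/
theorem exp_sumAge_ge (hp : p ≤ 1) (hε : 0 ≤ ε) (hS : ∀ j ∈ S, (θ j : ℝ) = p)
    (hS' : ∀ j ∉ S, (θ j : ℝ) = p - ε) (i : Fin M) :
    (∑ t ∈ Finset.range T, meanAge p (t + 1)) +
        ε * adaptiveExp (roundWeight π θ) T (misses S i T) ≤
      adaptiveExp (roundWeight π θ) T (sumAge i T) := by
  have hw := isStochastic_roundWeight π θ
  induction T with
  | zero => simp [adaptiveExp, misses, sumAge]
  | succ T ih =>
    rw [Finset.sum_range_succ, exp_sumAge_succ]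
    have h1 : adaptiveExp (roundWeight π θ) (T + 1) (misses S i (T + 1)) =
        adaptiveExp (roundWeight π θ) T (misses S i T) + adaptiveExp (roundWeight π θ) T
          (fun h => ∑ y, roundWeight π θ T h y * if y.1 i ∈ S then 0 else 1) :=
      hw.exp_additive_succ fun y => if y.1 i ∈ S then 0 else 1
    have h2 := exp_finalAge_succ_ge (T := T) π θ hε hS hS' i
    have h3 := mul_le_mul_of_nonneg_left
      (meanAge_le_exp_finalAge (T := T) π θ hp hε hS hS' i) (sub_nonneg.2 hp)
    rw [h1, meanAge]
    linarith

end LowerBound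

theorem exp_finalAge_staticPolicy {p : ℝ} {k : Alloc M N} (i : Fin M) (hk : (θ (k i) : ℝ) = p) :
    adaptiveExp (roundWeight (staticPolicy k) θ) T (finalAge i T) = meanAge p T := by
  classical
  induction T with
  | zero => simp [adaptiveExp, adaptiveWeight, finalAge, meanAge, age]
  | succ T ih =>
    rw [exp_finalAge_succ, meanAge, ← ih, ← adaptiveExp_const_mul]
    simp [staticPolicy, PMF.pure_apply, apply_ite ENNReal.toReal, hk]

theorem exp_sumAge_staticPolicy {p : ℝ} {k : Alloc M N} (i : Fin M) (hk : (θ (k i) : ℝ) = p) :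
    adaptiveExp (roundWeight (staticPolicy k) θ) T (sumAge i T) =
      ∑ t ∈ Finset.range T, meanAge p (t + 1) := by
  induction T with
  | zero => simp [adaptiveExp, sumAge]
  | succ T ih =>
    rw [exp_sumAge_succ, ih, exp_finalAge_staticPolicy θ i hk, Finset.sum_range_succ]

theorem stateExp_policyExp_totalAge (T : ℕ) :
    stateExp θ (fun x : States N T => policyExp π x (totalAge x)) =
      ∑ i, adaptiveExp (roundWeight π θ) T (sumAge i T) := by
  rw [← adaptiveExp_sum]
  exact stateExp_policyExp π θ fun _ g => ∑ i, ∑ t : Fin T, (age (fun s => g s i) (t + 1) : ℝ)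

/-- The regret against an allocation of best channels is at least `ε` times the number of
uses of other channels. -/
theorem le_stateExp_sub_iInf {S : Finset (Fin N)} {p ε : ℝ} (hp : p ≤ 1) (hε : 0 ≤ ε)
    (hS : ∀ j ∈ S, (θ j : ℝ) = p) (hS' : ∀ j ∉ S, (θ j : ℝ) = p - ε) {k : Alloc M N}
    (hk : ∀ i, k i ∈ S) (T : ℕ) :
    ε * adaptiveExp (roundWeight π θ) T (fun h => ∑ i, misses S i T h) ≤
      stateExp θ (fun x : States N T => policyExp π x (totalAge x)) -
        ⨅ k : Alloc M N, stateExp θ (fun x : States N T => totalAge x (fun _ => k)) := by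
  have h1 : ⨅ k : Alloc M N, stateExp θ (fun x : States N T => totalAge x (fun _ => k)) ≤
      ∑ _i : Fin M, ∑ t ∈ Finset.range T, meanAge p (t + 1) := by
    refine (ciInf_le (Set.finite_range _).bddBelow k).trans_eq ?_
    have h : (fun x : States N T => totalAge x fun _ => k) =
        fun x => policyExp (staticPolicy k) x (totalAge x) :=
      funext fun x => (policyExp_staticPolicy k x (totalAge x)).symm
    rw [h, stateExp_policyExp_totalAge]
    exact Finset.sum_congr rfl fun i _ => exp_sumAge_staticPolicy θ i (hS _ (hk i))
  have h2 := Finset.sum_le_sum fun i (_ : i ∈ (Finset.univ : Finset (Fin M))) =>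
    exp_sumAge_ge (T := T) π θ hp hε hS hS' i
  rw [stateExp_policyExp_totalAge, adaptiveExp_sum]
  rw [Finset.sum_add_distrib, ← Finset.mul_sum] at h2
  linarith

/-- Knowledge of the states only helps the oracle. -/
theorem stateExp_sub_iInf_le [Nonempty (Alloc M N)] (F : States N T → ℝ) :
    (stateExp θ F - ⨅ k : Alloc M N, stateExp θ (fun x : States N T => totalAge x (fun _ => k))) ≤
      stateExp θ (fun x => F x - ⨅ k : Fin T → Alloc M N, totalAge x k) := by
  have h1 : stateExp θ (fun x : States N T => ⨅ k : Fin T → Alloc M N, totalAge x k) ≤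
      ⨅ k : Alloc M N, stateExp θ (fun x : States N T => totalAge x (fun _ => k)) := by
    refine le_ciInf fun k => Finset.sum_le_sum fun x _ => mul_le_mul_of_nonneg_left
      (ciInf_le (Set.finite_range _).bddBelow _) ?_
    exact Finset.prod_nonneg fun t _ => Finset.prod_nonneg fun j _ => bernoulliWeight_nonneg _ _
  have h2 : stateExp θ (fun x => F x - ⨅ k : Fin T → Alloc M N, totalAge x k) =
      stateExp θ F - stateExp θ (fun x : States N T => ⨅ k : Fin T → Alloc M N, totalAge x k) := by
    simp only [stateExp, mul_sub, Finset.sum_sub_distrib]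
  linarith

end AoISched

namespace AoISched

/-! ### Change of measure from fair channels -/

variable {M N T : ℕ}

/-- Number of uses of channels of `S` by all clients. -/
noncomputable def uses (S : Finset (Fin N)) (T : ℕ) (h : Fin T → Alloc M N × (Fin M → Bool)) : ℝ :=
  ∑ t : Fin T, ∑ i, if (h t).1 i ∈ S then 1 else 0

theorem sum_misses (S : Finset (Fin N)) (h : Fin T → Alloc M N × (Fin M → Bool)) :
    ∑ i, misses S i T h = M * T - uses S T h := by
  have h1 : ∀ t i, (if (h t).1 i ∈ S then (0 : ℝ) else 1) =
      1 - if (h t).1 i ∈ S then 1 else 0 := by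
    intro t i
    split_ifs <;> norm_num
  simp only [misses, uses, h1]
  rw [Finset.sum_comm]
  simp [mul_comm]

theorem uses_nonneg (S : Finset (Fin N)) (h : Fin T → Alloc M N × (Fin M → Bool)) :
    0 ≤ uses S T h :=
  Finset.sum_nonneg fun _ _ => Finset.sum_nonneg fun _ _ => by split_ifs <;> norm_num

theorem uses_le (S : Finset (Fin N)) (h : Fin T → Alloc M N × (Fin M → Bool)) :
    uses S T h ≤ M * T := by
  have h1 : 0 ≤ ∑ i, misses S i T h :=
    Finset.sum_nonneg fun _ _ => Finset.sum_nonneg fun _ _ => by split_ifs <;> norm_num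
  rw [sum_misses] at h1
  linarith

/-- All channels are fair coins. -/
noncomputable def fairMeans : Fin N → unitInterval := fun _ => ⟨1 / 2, by norm_num, by norm_num⟩

/-- Likelihood ratio of the outcomes of one round against fair channels. -/
def likelihoodRatio (θ : Fin N → unitInterval) (y : Alloc M N × (Fin M → Bool)) : ℝ :=
  ∏ i, 2 * bernoulliWeight (θ (y.1 i)) (y.2 i)

variable (π : Policy M N) {θ : Fin N → unitInterval}

theorem adaptiveWeight_eq_mul_likelihoodRatio (θ : Fin N → unitInterval)
    (h : Fin T → Alloc M N × (Fin M → Bool)) :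
    adaptiveWeight (roundWeight π θ) T h =
      adaptiveWeight (roundWeight π fairMeans) T h * ∏ t, likelihoodRatio θ (h t) := by
  rw [adaptiveWeight, adaptiveWeight, ← Finset.prod_mul_distrib]
  refine Finset.prod_congr rfl fun t _ => ?_
  rw [roundWeight, roundWeight, likelihoodRatio, mul_assoc, ← Finset.prod_mul_distrib]
  congr 1
  refine Finset.prod_congr rfl fun i _ => ?_
  have : ∀ b, bernoulliWeight ((fairMeans (N := N) ((h t).1 i) : unitInterval) : ℝ) b = 1 / 2 := by
    intro b
    cases b <;> norm_num [bernoulliWeight, fairMeans]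
  rw [this]
  ring

theorem bernoulliWeight_pos {p : ℝ} (h0 : 0 < p) (h1 : p < 1) (b : Bool) :
    0 < bernoulliWeight p b := by
  cases b
  · simpa [bernoulliWeight] using h1
  · simpa [bernoulliWeight] using h0

section Divergence

variable {S : Finset (Fin N)} {ε : ℝ}

theorem likelihoodRatio_pos (h0 : ∀ j, 0 < (θ j : ℝ)) (h1 : ∀ j, (θ j : ℝ) < 1)
    (y : Alloc M N × (Fin M → Bool)) : 0 < likelihoodRatio θ y :=
  Finset.prod_pos fun _ _ => mul_pos two_pos (bernoulliWeight_pos (h0 _) (h1 _) _)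

/-- A fair channel contributes no logarithm. A channel of `S` contributes the mean of `log (1 + 2 *
ε)` and `log (1 - 2 * ε)` under a fair coin. -/
theorem sum_roundWeight_mul_log_likelihoodRatio (hε : 0 ≤ ε) (hε' : ε ≤ 1 / 4)
    (hS : ∀ j ∈ S, (θ j : ℝ) = 1 / 2 + ε) (hS' : ∀ j ∉ S, (θ j : ℝ) = 1 / 2) (t : ℕ)
    (h : Fin t → Alloc M N × (Fin M → Bool)) :
    ∑ y, roundWeight π fairMeans t h y * Real.log (likelihoodRatio θ y) =
      ∑ y, roundWeight π fairMeans t h y *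
        (Real.log (1 - 4 * ε ^ 2) / 2 * ∑ i, if y.1 i ∈ S then 1 else 0) := by
  have h0 : ∀ j, 0 < (θ j : ℝ) ∧ (θ j : ℝ) < 1 := by
    intro j
    by_cases hj : j ∈ S
    · rw [hS j hj]
      constructor <;> linarith
    · rw [hS' j hj]
      norm_num
  have hlog : ∀ y : Alloc M N × (Fin M → Bool), Real.log (likelihoodRatio θ y) =
      ∑ i, Real.log (2 * bernoulliWeight (θ (y.1 i)) (y.2 i)) := fun y =>
    Real.log_prod fun i _ => (mul_pos two_pos (bernoulliWeight_pos (h0 _).1 (h0 _).2 _)).ne'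
  simp only [hlog, Finset.mul_sum]
  refine (Finset.sum_comm.trans (Finset.sum_congr rfl fun i _ => ?_)).trans Finset.sum_comm
  rw [sum_roundWeight_mul π fairMeans t h i fun k b => Real.log (2 * bernoulliWeight (θ (k i)) b),
    sum_roundWeight_fst π fairMeans t h
      fun k => Real.log (1 - 4 * ε ^ 2) / 2 * if k i ∈ S then 1 else 0]
  refine Finset.sum_congr rfl fun k _ => ?_
  congr 1
  by_cases hk : k i ∈ S
  · rw [hS _ hk, if_pos hk]
    have h2 : 1 - 4 * ε ^ 2 = (2 * (1 / 2 + ε)) * (2 * (1 - (1 / 2 + ε))) := by ring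
    rw [h2, Real.log_mul (by linarith) (by linarith)]
    simp only [Fintype.sum_bool, bernoulliWeight, fairMeans, if_true, Bool.false_eq_true, if_false]
    ring
  · rw [hS' _ hk, if_neg hk]
    norm_num [bernoulliWeight]

theorem neg_log_one_sub_le (hε : 0 ≤ ε) (hε' : ε ≤ 1 / 4) :
    -(Real.log (1 - 4 * ε ^ 2) / 2) ≤ 4 * ε ^ 2 := by
  have h1 : 4 * ε ^ 2 ≤ 1 / 4 := by nlinarith
  have h2 := Real.one_sub_inv_le_log_of_pos (show 0 < 1 - 4 * ε ^ 2 by linarith)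
  have h3 : (1 - 4 * ε ^ 2)⁻¹ ≤ 1 + 8 * ε ^ 2 := by
    rw [inv_le_iff_one_le_mul₀ (by linarith)]
    nlinarith [sq_nonneg ε]
  linarith

/-- Raising the means of the channels of `S` from `1 / 2` to `1 / 2 + ε` changes the expected
number of their uses by little. -/
theorem exp_uses_le (hε : 0 ≤ ε) (hε' : ε ≤ 1 / 4)
    (hS : ∀ j ∈ S, (θ j : ℝ) = 1 / 2 + ε) (hS' : ∀ j ∉ S, (θ j : ℝ) = 1 / 2) :
    adaptiveExp (roundWeight π θ) T (uses S T) ≤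
      adaptiveExp (roundWeight π fairMeans) T (uses S T) +
        M * T * (4 * ε * √(adaptiveExp (roundWeight π fairMeans) T (uses S T))) := by
  have hw := isStochastic_roundWeight π (fairMeans (N := N))
  have h0 : ∀ j, 0 < (θ j : ℝ) ∧ (θ j : ℝ) < 1 := by
    intro j
    by_cases hj : j ∈ S
    · rw [hS j hj]
      constructor <;> linarith
    · rw [hS' j hj]
      norm_num
  set p := adaptiveWeight (roundWeight π (fairMeans (N := N))) T with hp
  set E := adaptiveExp (roundWeight π fairMeans) T (uses S T) with hE
  let R : (Fin T → Alloc M N × (Fin M → Bool)) → ℝ := fun h => ∏ t, likelihoodRatio θ (h t)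
  have hR : ∀ h, 0 < R h := fun h =>
    Finset.prod_pos fun t _ => likelihoodRatio_pos (fun j => (h0 j).1) (fun j => (h0 j).2) _
  have hpR : ∀ h, adaptiveWeight (roundWeight π θ) T h = p h * R h :=
    adaptiveWeight_eq_mul_likelihoodRatio π θ
  have hp0 : ∀ h, 0 ≤ p h := hw.weight_nonneg
  have hsum : ∑ h, p h * R h = 1 := by
    simp only [← hpR]
    exact (isStochastic_roundWeight π θ).sum_weight
  have hKL : ∑ h, p h * -Real.log (R h) ≤ 4 * ε ^ 2 * E := by
    have h1 : ∑ h, p h * Real.log (R h) = Real.log (1 - 4 * ε ^ 2) / 2 * E := by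
      have h2 := hw.exp_additive_congr (T := T)
        (sum_roundWeight_mul_log_likelihoodRatio π hε hε' hS hS')
      simp only [← Finset.mul_sum] at h2
      rw [adaptiveExp_const_mul] at h2
      refine Eq.trans (Finset.sum_congr rfl fun h _ => ?_) h2
      rw [Real.log_prod fun t _ =>
        (likelihoodRatio_pos (fun j => (h0 j).1) (fun j => (h0 j).2) _).ne']
    simp only [mul_neg, Finset.sum_neg_distrib, h1]
    rw [← neg_mul]
    refine mul_le_mul_of_nonneg_right (neg_log_one_sub_le hε hε') ?_
    exact Finset.sum_nonneg fun h _ => mul_nonneg (hp0 h) (uses_nonneg S h)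
  have hTV : ∑ h, p h * |1 - R h| ≤ 4 * ε * √E := by
    refine (Real.le_sqrt_of_sq_le ((sq_sum_abs_one_sub_le hp0 hR hw.sum_weight hsum).trans
      (mul_le_mul_of_nonneg_left hKL (by norm_num)))).trans_eq ?_
    rw [show 4 * (4 * ε ^ 2 * E) = (4 * ε) ^ 2 * E by ring, Real.sqrt_mul (sq_nonneg _),
      Real.sqrt_sq (by linarith)]
  have hle : adaptiveExp (roundWeight π θ) T (uses S T) ≤
      E + M * T * ∑ h, p h * |1 - R h| := by
    rw [hE, adaptiveExp, adaptiveExp, Finset.mul_sum, ← Finset.sum_add_distrib]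
    refine Finset.sum_le_sum fun h _ => ?_
    rw [hpR]
    -- Total variation controls the change in expectation because the uses lie between `0` and `M *
    -- T`.
    have h1 : (R h - 1) * uses S T h ≤ |1 - R h| * (M * T) := by
      refine mul_le_mul (by rw [abs_sub_comm]; exact le_abs_self _) (uses_le S h)
        (uses_nonneg S h) (abs_nonneg _)
    have h2 := mul_le_mul_of_nonneg_left h1 (hp0 h)
    rw [← hp]
    linarith
  exact hle.trans (add_le_add_right (mul_le_mul_of_nonneg_left hTV (by positivity)) E)

end Divergence

/-! ### Averaging over the cyclic windows -/

section Shifts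

variable [NeZero N]

/-- Allocation of `M` cyclically consecutive channels, starting from `a`. -/
def shiftAlloc (hMN : M ≤ N) (a : Fin N) : Alloc M N :=
  (Fin.castLEEmb hMN).trans (addRightEmbedding a)

/-- The window from `a` contains `j` exactly when `a = j - i` for one of the `M` offsets `i`;
injectivity of the allocation ensures that at most one offset counts. -/
theorem sum_mem_shiftAlloc (hMN : M ≤ N) (j : Fin N) :
    ∑ a, (if j ∈ Finset.univ.map (shiftAlloc hMN a) then (1 : ℝ) else 0) = M := by
  have h1 : ∀ a, (if j ∈ Finset.univ.map (shiftAlloc hMN a) then (1 : ℝ) else 0) =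
      ∑ i : Fin M, if a = j - Fin.castLE hMN i then 1 else 0 := by
    intro a
    have h2 : ∀ i, a = j - Fin.castLE hMN i ↔ shiftAlloc hMN a i = j := fun i =>
      eq_sub_iff_add_eq'
    simp only [h2]
    by_cases hj : j ∈ Finset.univ.map (shiftAlloc hMN a)
    · rw [if_pos hj]
      obtain ⟨i, -, rfl⟩ := Finset.mem_map.1 hj
      simp
    · rw [if_neg hj, Finset.sum_eq_zero]
      intro i _
      exact if_neg fun h => hj (Finset.mem_map.2 ⟨i, Finset.mem_univ i, h⟩)
  simp only [h1]
  rw [Finset.sum_comm]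
  simp

theorem sum_uses_shiftAlloc (hMN : M ≤ N) (h : Fin T → Alloc M N × (Fin M → Bool)) :
    ∑ a, uses (Finset.univ.map (shiftAlloc hMN a)) T h = M * (M * T) := by
  simp only [uses]
  rw [Finset.sum_comm]
  have h1 : ∀ t, ∑ a, ∑ i, (if (h t).1 i ∈ Finset.univ.map (shiftAlloc hMN a) then (1 : ℝ) else 0) =
      M * M := by
    intro t
    rw [Finset.sum_comm]
    simp only [sum_mem_shiftAlloc]
    simp
  simp only [h1]
  simp
  ring

theorem sum_exp_misses_ge (hMN : M ≤ N) {ε : ℝ} (hε : 0 ≤ ε) (hε' : ε ≤ 1 / 4)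
    (hεN : 8 * ε * (M * √((N : ℝ) * T)) ≤ N - M) {θ : Fin N → Fin N → unitInterval}
    (hS : ∀ a, ∀ j ∈ Finset.univ.map (shiftAlloc hMN a), (θ a j : ℝ) = 1 / 2 + ε)
    (hS' : ∀ a, ∀ j ∉ Finset.univ.map (shiftAlloc hMN a), (θ a j : ℝ) = 1 / 2) :
    (M * T * ((N : ℝ) - M)) / 2 ≤ ∑ a, adaptiveExp (roundWeight π (θ a)) T
      (fun h => ∑ i, misses (Finset.univ.map (shiftAlloc hMN a)) i T h) := by
  let S : Fin N → Finset (Fin N) := fun a => Finset.univ.map (shiftAlloc hMN a)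
  let E : Fin N → ℝ := fun a => adaptiveExp (roundWeight π fairMeans) T (uses (S a) T)
  have hw := isStochastic_roundWeight π (fairMeans (N := N))
  have hE : ∀ a, 0 ≤ E a := fun a =>
    Finset.sum_nonneg fun h _ => mul_nonneg (hw.weight_nonneg h) (uses_nonneg (S a) h)
  have hsum : ∑ a, E a = M * (M * T) := by
    rw [← adaptiveExp_sum]
    simp only [S, sum_uses_shiftAlloc, hw.exp_const]
  have hsqrt : ∑ a, √(E a) ≤ M * √((N : ℝ) * T) := by
    -- Cauchy–Schwarz over the `N` windows.
    refine (Real.le_sqrt_of_sq_le (sq_sum_le_card_mul_sum_sq (s := Finset.univ)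
      (f := fun a => √(E a)))).trans_eq ?_
    simp only [Real.sq_sqrt (hE _), hsum, Finset.card_univ, Fintype.card_fin]
    rw [show (N : ℝ) * (M * (M * T)) = (M : ℝ) ^ 2 * (N * T) by ring,
      Real.sqrt_mul (sq_nonneg _), Real.sqrt_sq (Nat.cast_nonneg _)]
  have hmiss : ∀ a, adaptiveExp (roundWeight π (θ a)) T (fun h => ∑ i, misses (S a) i T h) =
      M * T - adaptiveExp (roundWeight π (θ a)) T (uses (S a) T) := by
    intro a
    have h1 := (isStochastic_roundWeight π (θ a)).exp_const (T := T) ((M : ℝ) * T)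
    have h2 : adaptiveExp (roundWeight π (θ a)) T (fun h => ∑ i, misses (S a) i T h) +
        adaptiveExp (roundWeight π (θ a)) T (uses (S a) T) = M * T := by
      rw [← adaptiveExp_add]
      simpa only [sum_misses, sub_add_cancel] using h1
    linarith
  have hle : ∑ a, adaptiveExp (roundWeight π (θ a)) T (uses (S a) T) ≤
      M * (M * T) + M * T * (4 * ε * (M * √((N : ℝ) * T))) := by
    refine (Finset.sum_le_sum fun a _ => exp_uses_le π hε hε' (hS a) (hS' a)).trans ?_
    rw [Finset.sum_add_distrib, ← Finset.mul_sum, ← Finset.mul_sum]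
    refine add_le_add hsum.le (mul_le_mul_of_nonneg_left
      (mul_le_mul_of_nonneg_left hsqrt (by positivity)) (by positivity))
  -- The choice of `ε` lets the information gain recover at most half of the gap `M * T * (N - M)`
  -- left by blind play.
  have h3 : (M : ℝ) * T * (4 * ε * (M * √((N : ℝ) * T))) ≤ M * T * (((N : ℝ) - M) / 2) :=
    mul_le_mul_of_nonneg_left (by linarith) (by positivity)
  change _ ≤ ∑ a, adaptiveExp (roundWeight π (θ a)) T (fun h => ∑ i, misses (S a) i T h)
  simp only [hmiss, Finset.sum_sub_distrib, Finset.sum_const, Finset.card_univ, Fintype.card_fin,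
    nsmul_eq_mul]
  linarith

end Shifts

/-! ### Uniform mixture of configurations -/

section Uniform

variable {Ω : Type*} [MeasurableSpace Ω]

/-- The uniform distribution on the values of a finite family. -/
noncomputable def uniformOn (N : ℕ) [NeZero N] (ω : Fin N → Ω) : ProbabilityMeasure Ω :=
  ⟨∑ a, (N : ENNReal)⁻¹ • Measure.dirac (ω a), ⟨by
    have h : (N : ENNReal) ≠ 0 := Nat.cast_ne_zero.2 (NeZero.ne N)
    simp [ENNReal.mul_inv_cancel h (ENNReal.natCast_ne_top N)]⟩⟩

/-- With measurable singletons every real function is integrable against a Dirac mass, so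
measurability of the regret in the configuration is not needed. -/
theorem integral_uniformOn [NeZero N] [MeasurableSingletonClass Ω] (ω : Fin N → Ω) (f : Ω → ℝ) :
    ∫ x, f x ∂(uniformOn N ω : Measure Ω) = (N : ℝ)⁻¹ * ∑ a, f (ω a) := by
  have h : (uniformOn N ω : Measure Ω) = ∑ a, (N : ENNReal)⁻¹ • Measure.dirac (ω a) := rfl
  have hN : (N : ENNReal)⁻¹ ≠ ⊤ := ENNReal.inv_ne_top.2 (Nat.cast_ne_zero.2 (NeZero.ne N))
  rw [h, integral_finsetSum_measure fun a _ =>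
    (integrable_dirac enorm_lt_top).smul_measure hN, Finset.mul_sum]
  refine Finset.sum_congr rfl fun a _ => ?_
  rw [integral_smul_measure, integral_dirac]
  simp

end Uniform

end AoISched

/-! ### Choice of the gap and conclusion -/

open AoISched
theorem theorem2 :
    ∃ c : ℝ, 0 < c ∧ ∀ M N T : ℕ, 1 ≤ M → M ≤ N →
      (N : ℝ) - M ≤ 2 * M * √((N : ℝ) * T) →
      ∃ ρ : MeasureTheory.ProbabilityMeasure (Fin N → unitInterval), ∀ π : Policy M N,
        c * (((N : ℝ) - M) ^ 2 / (N : ℝ) ^ 2 * √((N : ℝ) * T))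
            ≤ regretBestArm T (ρ : MeasureTheory.Measure (Fin N → unitInterval)) π ∧
        c * (((N : ℝ) - M) ^ 2 / (N : ℝ) ^ 2 * √((N : ℝ) * T))
            ≤ regretCSI T (ρ : MeasureTheory.Measure (Fin N → unitInterval)) π := by
  refine ⟨1 / 16, by norm_num, fun M N T hM hMN hNM => ?_⟩
  have : NeZero N := ⟨by omega⟩
  have hM0 : (0 : ℝ) < M := by exact_mod_cast hM
  have hN0 : (0 : ℝ) < N := hM0.trans_le (by exact_mod_cast hMN)
  have hd : (0 : ℝ) ≤ N - M := sub_nonneg.2 (by exact_mod_cast hMN)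
  -- The bound `ε ≤ 1 / 4` is exactly the hypothesis on `N - M`. If `√(N * T) = 0`, that hypothesis
  -- forces `N = M`, and `ε = 0` works.
  obtain ⟨ε, hε, hε', hεN⟩ : ∃ ε : ℝ, 0 ≤ ε ∧ ε ≤ 1 / 4 ∧
      8 * ε * (M * √((N : ℝ) * T)) = N - M := by
    rcases (Real.sqrt_nonneg ((N : ℝ) * T)).eq_or_lt with h | h
    · rw [← h] at hNM ⊢
      exact ⟨0, le_rfl, by norm_num, by linarith⟩
    · refine ⟨((N : ℝ) - M) / (8 * (M * √((N : ℝ) * T))), by positivity, ?_, by field_simp⟩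
      rw [div_le_iff₀ (by positivity)]
      linarith
  let S : Fin N → Finset (Fin N) := fun a => Finset.univ.map (shiftAlloc hMN a)
  let θ : Fin N → Fin N → unitInterval := fun a j =>
    if j ∈ S a then ⟨1 / 2 + ε, by linarith, by linarith⟩ else ⟨1 / 2, by norm_num, by norm_num⟩
  have hS : ∀ a, ∀ j ∈ S a, (θ a j : ℝ) = 1 / 2 + ε := fun a j hj => by simp only [θ, if_pos hj]
  have hS' : ∀ a, ∀ j ∉ S a, (θ a j : ℝ) = 1 / 2 := fun a j hj => by simp only [θ, if_neg hj]
  refine ⟨uniformOn N θ, fun π => ?_⟩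
  have hbest : 1 / 16 * (((N : ℝ) - M) ^ 2 / (N : ℝ) ^ 2 * √((N : ℝ) * T)) ≤
      regretBestArm T (uniformOn N θ : Measure (Fin N → unitInterval)) π := by
    rw [regretBestArm, integral_uniformOn]
    have h1 := Finset.sum_le_sum fun a (_ : a ∈ Finset.univ) =>
      le_stateExp_sub_iInf π (θ a) (by linarith) hε (hS a)
        (fun j hj => (hS' a j hj).trans (add_sub_cancel_right _ _).symm)
        (fun i => Finset.mem_map_of_mem (shiftAlloc hMN a) (Finset.mem_univ i)) T
    rw [← Finset.mul_sum] at h1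
    have h2 := mul_le_mul_of_nonneg_left
      ((mul_le_mul_of_nonneg_left (sum_exp_misses_ge π hMN hε hε' hεN.le hS hS') hε).trans h1)
      (inv_nonneg.2 hN0.le)
    -- Once `N - M` is expressed through `ε`, both sides equal `4 * ε ^ 2 * M ^ 2 * T * √(N * T) /
    -- N`; this fixes the constant `1 / 16`.
    refine le_trans (le_of_eq ?_) h2
    have hsq : √((N : ℝ) * T) ^ 2 = N * T := Real.sq_sqrt (by positivity)
    rw [← hεN]
    field_simp
    linear_combination 16 * ε ^ 2 * √((N : ℝ) * T) * hsq
  refine ⟨hbest, hbest.trans ?_⟩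
  rw [regretCSI, regretBestArm, integral_uniformOn, integral_uniformOn]
  have : Nonempty (Alloc M N) := ⟨Fin.castLEEmb hMN⟩
  exact mul_le_mul_of_nonneg_left (Finset.sum_le_sum fun a _ => stateExp_sub_iInf_le _ _)
    (inv_nonneg.2 hN0.le)
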